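/- Let $X,Y$ be real Hilbert spaces, $A:X\to Y$ a bounded linear operator, $C\subset X$ a closed convex set, and let $y\in Y$ be such that $Ax=y$ has a solution in $C$. Then there is a unique solution $x^\dagger$ of $\min\{\tfrac12\|x\|^2 : x\in C,\ Ax=y\}$. Let $P_C$ denote the metric projection of $X$ onto $C$. For $\delta>0$ and noisy data $y^\delta\in Y$ with $\|y^\delta-y\|\le\delta$, and a step size $\gamma>0$, consider the dual projected Landweber iteration $$\lambda_0=0,\qquad x_n=P_C(A^*\lambda_n),\qquad \lambda_{n+1}=\lambda_n-\gamma(Ax_n-y^\delta)\qquad(n\ge 0).$$ The projected source condition with exponent $\nu$ is $$x^\dagger=P_C\big((A^*A)^{\nu/2}\omega\big)\quad\text{for some }\omega\in X, \qquad 0<\nu\le 1. \tag{1}$$ (i) Let $0<\gamma\le 1/\|A\|^2$ (any $\gamma>0$ if $A=0$). If integers $n_\delta$ are chosen such that $n_\delta\to\infty$ and $\delta^2n_\delta\to0$ as $\delta\to0$, then $\|x_{n_\delta}-x^\dagger\|\to0$ as $\delta\to0$. If in addition (1) holds and $n_\delta\sim\delta^{-2/(1+\nu)}$ (that is, for small $\delta$,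 $n_\delta$ lies between two positive constant multiples of $\delta^{-2/(1+\nu)}$), then $\|x_{n_\delta}-x^\dagger\|=O(\delta^{\nu/(1+\nu)})$ as $\delta\to0$. (ii) Let $\tau>1$ and $\gamma>0$ satisfy $1-1/\tau-\|A\|^2\gamma>0$. Then for all $\delta>0$ and all $y^\delta$ with $\|y^\delta-y\|\le\delta$ the discrepancy principle $$\|Ax_{n_\delta}-y^\delta\|\le\tau\delta<\|Ax_n-y^\delta\|,\qquad 0\le n<n_\delta,$$ defines a finite integer $n_\delta$, and $\|x_{n_\delta}-x^\dagger\|\to0$ as $\delta\to0$. If in addition (1) holds, then $\|x_{n_\delta}-x^\dagger\|=O(\delta^{\nu/(1+\nu)})$ as $\delta\to0$. All limits and $O$-bounds hold uniformly over all data $y^\delta$ with $\|y^\delta-y\|\le\delta$. -/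

import Mathlib

open Filter Topology Asymptotics

noncomputable section

namespace DualLandweber

section OperatorPower

open Polynomial

variable {H : Type*} [NormedAddCommGroup H] [InnerProductSpace ℝ H] [CompleteSpace H]

/-- `IsOpPow T s B` says that `B` is the power `T ^ s` of the positive bounded operator `T` on a
real Hilbert space in the sense of the continuous functional calculus: `B` is the limit in operator
norm of `p k (T)` for real polynomials `p k` that converge to `t ↦ t ^ s` uniformly on `[0, ‖T‖]`
(an interval that contains the spectrum of `T`). Existence and uniqueness of such a `B` are proved
in `existsUnique_isOpPow` below. -/
def IsOpPow (T : H →L[ℝ] H) (s : ℝ) (B : H →L[ℝ] H) : Prop :=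
  ∃ p : ℕ → ℝ[X],
    TendstoUniformlyOn (fun k t => (p k).eval t) (fun t => t ^ s) atTop (Set.Icc 0 ‖T‖) ∧
    Tendsto (fun k => aeval T (p k)) atTop (𝓝 B)

/-- The power `T ^ s` of a positive bounded operator `T` on a real Hilbert space, `0 ≤ s`. -/
def opPow (T : H →L[ℝ] H) (s : ℝ) : H →L[ℝ] H :=
  Classical.epsilon (IsOpPow T s)

theorem isUnit_quadratic {S : H →L[ℝ] H} (hS : IsSelfAdjoint S) {d : ℝ} (hd : 0 < d) :
    IsUnit (S ^ 2 + algebraMap ℝ (H →L[ℝ] H) d) := by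
  refine ContinuousLinearMap.isUnit_of_forall_le_norm_inner_map _ (c := ⟨d, hd.le⟩) hd fun x => ?_
  have h1 : inner ℝ ((S ^ 2 + algebraMap ℝ (H →L[ℝ] H) d) x) x = ‖S x‖ ^ 2 + d * ‖x‖ ^ 2 := by
    have h2 : inner ℝ (S (S x)) x = inner ℝ (S x) (S x) := hS.isSymmetric (S x) x
    have h3 : (S ^ 2 + algebraMap ℝ (H →L[ℝ] H) d) x = S (S x) + d • x := by
      simp [pow_two, Algebra.algebraMap_eq_smul_one]
    rw [h3, inner_add_left, h2, inner_smul_left, real_inner_self_eq_norm_sq,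
      real_inner_self_eq_norm_sq]
    simp
  rw [h1, Real.norm_eq_abs]
  refine le_trans ?_ (le_abs_self _)
  change ‖x‖ ^ 2 * d ≤ _
  nlinarith [sq_nonneg ‖S x‖]

theorem exists_root_of_irreducible {T : H →L[ℝ] H} (hT : IsSelfAdjoint T) {q : ℝ[X]}
    (hq : Irreducible q) (hu : ¬ IsUnit (aeval T q)) : ∃ μ ∈ spectrum ℝ T, q.eval μ = 0 := by
  have hdeg : (q.map (algebraMap ℝ ℂ)).degree ≠ 0 := by
    rw [degree_map]
    exact fun h => hq.not_isUnit (isUnit_iff_degree_eq_zero.2 h)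
  obtain ⟨z, hz⟩ := IsAlgClosed.exists_root _ hdeg
  have hz0 : aeval z q = 0 := by rwa [IsRoot, eval_map_algebraMap] at hz
  by_cases him : z.im = 0
  · have hzr : z = ((z.re : ℝ) : ℂ) := Complex.ext rfl (by simp [him])
    have hroot : q.eval z.re = 0 := by
      rw [hzr] at hz0
      have h := aeval_algebraMap_apply ℂ z.re q
      rw [Complex.coe_algebraMap, hz0] at h
      simpa [aeval_def] using h.symm
    refine ⟨z.re, ?_, hroot⟩
    obtain ⟨u, rfl⟩ := dvd_iff_isRoot.2 hroot
    have hu' : IsUnit u := (hq.isUnit_or_isUnit rfl).resolve_left (not_isUnit_X_sub_C _)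
    rw [spectrum.mem_iff, IsUnit.sub_iff]
    intro h
    refine hu ?_
    rw [map_mul]
    exact IsUnit.mul (by simpa using h) (hu'.map (aeval T))
  · exfalso
    obtain ⟨u, rfl⟩ := quadratic_dvd_of_aeval_eq_zero_im_ne_zero q hz0 him
    have hnu : ¬ IsUnit (X ^ 2 - C (2 * z.re) * X + C (‖z‖ ^ 2) : ℝ[X]) := by
      intro h
      have h1 := natDegree_eq_zero_of_isUnit h
      have h2 : (X ^ 2 - C (2 * z.re) * X + C (‖z‖ ^ 2) : ℝ[X]).natDegree = 2 := by compute_degree!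
      omega
    have hu' : IsUnit u := (hq.isUnit_or_isUnit rfl).resolve_left hnu
    refine hu ?_
    rw [map_mul]
    refine IsUnit.mul ?_ (hu'.map (aeval T))
    have hsa : IsSelfAdjoint (T - algebraMap ℝ (H →L[ℝ] H) z.re) :=
      hT.sub (IsSelfAdjoint.algebraMap _ (IsSelfAdjoint.all _))
    have key := isUnit_quadratic hsa (d := z.im ^ 2) (by positivity)
    convert key using 1
    have h3 : (X ^ 2 - C (2 * z.re) * X + C (‖z‖ ^ 2) : ℝ[X])
        = (X - C z.re) ^ 2 + C (z.im ^ 2) := by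
      rw [Complex.sq_norm, Complex.normSq_apply]
      simp only [map_mul, map_add, map_pow, map_ofNat]
      ring
    rw [h3]
    simp

theorem exists_root_of_not_isUnit {T : H →L[ℝ] H} (hT : IsSelfAdjoint T) (q : ℝ[X]) :
    q ≠ 0 → ¬ IsUnit (aeval T q) → ∃ μ ∈ spectrum ℝ T, q.eval μ = 0 := by
  induction q using WfDvdMonoid.induction_on_irreducible with
  | zero => exact fun h => absurd rfl h
  | unit u hu => exact fun _ h => absurd (hu.map (aeval T)) h
  | mul a i ha hi ih =>
    intro _ hnu
    by_cases h : IsUnit (aeval T i)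
    · have : ¬ IsUnit (aeval T a) := fun h' => hnu (by rw [map_mul]; exact h.mul h')
      obtain ⟨μ, h1, h2⟩ := ih ha this
      exact ⟨μ, h1, by simp [h2]⟩
    · obtain ⟨μ, h1, h2⟩ := exists_root_of_irreducible hT hi h
      exact ⟨μ, h1, by simp [h2]⟩

theorem isSelfAdjoint_aeval {T : H →L[ℝ] H} (hT : IsSelfAdjoint T) (p : ℝ[X]) :
    IsSelfAdjoint (aeval T p) := by
  induction p using Polynomial.induction_on' with
  | add p q hp hq => rw [map_add]; exact hp.add hq
  | monomial n a =>
    rw [aeval_monomial, ← Algebra.smul_def]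
    exact (IsSelfAdjoint.all a).smul (hT.pow n)

/-- The norm of a polynomial in a positive operator is at most the supremum of the polynomial over
`[0, ‖T‖]`. -/
theorem norm_aeval_le {T : H →L[ℝ] H} (hT : T.IsPositive) (p : ℝ[X]) {K : ℝ}
    (hK : ∀ t ∈ Set.Icc 0 ‖T‖, |p.eval t| ≤ K) : ‖aeval T p‖ ≤ K := by
  have h0 : |p.eval 0| ≤ K := hK 0 ⟨le_rfl, norm_nonneg _⟩
  have hK0 : 0 ≤ K := (abs_nonneg _).trans h0
  rcases subsingleton_or_nontrivial H with hH | hH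
  · have : aeval T p = 0 := Subsingleton.elim _ _
    simpa [this] using hK0
  have hsp : ∀ μ ∈ spectrum ℝ T, μ ∈ Set.Icc 0 ‖T‖ := by
    intro μ hμ
    refine ⟨SpectrumRestricts.nnreal_iff.1 hT.spectrumRestricts μ hμ, ?_⟩
    exact (le_abs_self μ).trans (spectrum.norm_le_norm_of_mem hμ)
  have hle : spectralRadius ℝ (aeval T p) ≤ (K.toNNReal : ENNReal) := by
    refine iSup₂_le fun l hl => ?_
    have : |l| ≤ K := by
      by_cases hp : p - C l = 0
      · have : p = C l := sub_eq_zero.1 hp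
        simpa [this] using h0
      · have hnu : ¬ IsUnit (aeval T (p - C l)) := by
          have h := hl
          rw [spectrum.mem_iff, IsUnit.sub_iff] at h
          simpa using h
        obtain ⟨μ, h1, h2⟩ := exists_root_of_not_isUnit hT.isSelfAdjoint _ hp hnu
        have h3 : p.eval μ = l := by simpa [sub_eq_zero] using h2
        rw [← h3]
        exact hK μ (hsp μ h1)
    have h4 : ‖l‖₊ ≤ K.toNNReal := by
      rw [← NNReal.coe_le_coe, Real.coe_toNNReal K hK0]
      exact this
    exact_mod_cast h4
  have h5 := ContinuousLinearMap.spectralRadius_eq_nnnorm _ (isSelfAdjoint_aeval hT.isSelfAdjoint p)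
  have h6 : ‖aeval T p‖₊ ≤ K.toNNReal := by
    rw [h5] at hle
    exact_mod_cast hle
  rwa [← NNReal.coe_le_coe, Real.coe_toNNReal K hK0] at h6

theorem existsUnique_isOpPow {T : H →L[ℝ] H} (hT : T.IsPositive) {s : ℝ} (hs : 0 ≤ s) :
    ∃! B, IsOpPow T s B := by
  have hdiff : ∀ p q : ℝ[X], ∀ e : ℝ,
      (∀ t ∈ Set.Icc 0 ‖T‖, |p.eval t - t ^ s| ≤ e) → (∀ t ∈ Set.Icc 0 ‖T‖, |q.eval t - t ^ s| ≤ e) →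
      ‖aeval T p - aeval T q‖ ≤ 2 * e := by
    intro p q e hp hq
    rw [← map_sub]
    refine norm_aeval_le hT _ fun t ht => ?_
    have h1 := abs_le.1 (hp t ht)
    have h2 := abs_le.1 (hq t ht)
    rw [eval_sub, abs_le]
    constructor <;> linarith [h1.1, h1.2, h2.1, h2.2]
  have hcont : ContinuousOn (fun t : ℝ => t ^ s) (Set.Icc 0 ‖T‖) :=
    (Real.continuous_rpow_const hs).continuousOn
  have hex : ∀ k : ℕ, ∃ p : ℝ[X], ∀ t ∈ Set.Icc 0 ‖T‖, |p.eval t - t ^ s| < 1 / ((k : ℝ) + 1) :=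
    fun k => exists_polynomial_near_of_continuousOn 0 ‖T‖ _ hcont _ Nat.one_div_pos_of_nat
  choose p hp using hex
  have hunif : TendstoUniformlyOn (fun k t => (p k).eval t) (fun t => t ^ s) atTop
      (Set.Icc 0 ‖T‖) := by
    rw [Metric.tendstoUniformlyOn_iff]
    intro e he
    obtain ⟨N, hN⟩ := exists_nat_one_div_lt he
    filter_upwards [eventually_ge_atTop N] with k hk t ht
    rw [dist_comm, Real.dist_eq]
    exact (hp k t ht).trans ((Nat.one_div_le_one_div hk).trans_lt hN)
  have hcau : CauchySeq (fun k => aeval T (p k)) := by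
    refine cauchySeq_of_le_tendsto_0' (fun k : ℕ => 2 * (1 / ((k : ℝ) + 1))) ?_ ?_
    · intro n m hnm
      rw [dist_eq_norm]
      exact hdiff _ _ _ (fun t ht => (hp n t ht).le)
        (fun t ht => (hp m t ht).le.trans (Nat.one_div_le_one_div hnm))
    · simpa using (tendsto_one_div_add_atTop_nhds_zero_nat (𝕜 := ℝ)).const_mul 2
  obtain ⟨B, hB⟩ := cauchySeq_tendsto_of_complete hcau
  refine ⟨B, ⟨p, hunif, hB⟩, ?_⟩
  rintro B' ⟨q, hq, hB'⟩
  have hz : Tendsto (fun k => aeval T (q k) - aeval T (p k)) atTop (𝓝 0) := by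
    rw [Metric.tendsto_atTop']
    intro e he
    rw [Metric.tendstoUniformlyOn_iff] at hq hunif
    obtain ⟨N, hN⟩ := eventually_atTop.1 ((hq (e / 3) (by positivity)).and
      (hunif (e / 3) (by positivity)))
    refine ⟨N, fun n hn => ?_⟩
    rw [dist_zero_right]
    obtain ⟨h1, h2⟩ := hN n hn.le
    refine (hdiff _ _ (e / 3) (fun t ht => ?_) (fun t ht => ?_)).trans_lt (by linarith)
    · have := (h1 t ht).le
      rwa [dist_comm, Real.dist_eq] at this
    · have := (h2 t ht).le
      rwa [dist_comm, Real.dist_eq] at this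
  exact sub_eq_zero.1 (tendsto_nhds_unique (hB'.sub hB) hz)

theorem isOpPow_opPow {T : H →L[ℝ] H} (hT : T.IsPositive) {s : ℝ} (hs : 0 ≤ s) :
    IsOpPow T s (opPow T s) :=
  Classical.epsilon_spec (existsUnique_isOpPow hT hs).exists

end OperatorPower

section Projection

variable {X : Type*} [NormedAddCommGroup X] [InnerProductSpace ℝ X]

/-- `p` is a point of `C` nearest to `ξ`. -/
def IsNearestPoint (C : Set X) (ξ p : X) : Prop :=
  p ∈ C ∧ ∀ z ∈ C, ‖ξ - p‖ ≤ ‖ξ - z‖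

/-- The metric projection of `ξ` onto `C` (for a nonempty closed convex subset `C` of a Hilbert
space the nearest point exists and is unique, see `existsUnique_isNearestPoint`). -/
def metricProj (C : Set X) (ξ : X) : X :=
  Classical.epsilon (IsNearestPoint C ξ)

theorem existsUnique_isNearestPoint [CompleteSpace X] {C : Set X} (hne : C.Nonempty)
    (hcl : IsClosed C) (hconv : Convex ℝ C) (ξ : X) : ∃! p, IsNearestPoint C ξ p := by
  have hiff : ∀ p, IsNearestPoint C ξ p ↔ p ∈ C ∧ ‖ξ - p‖ = ⨅ w : C, ‖ξ - w‖ := by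
    intro p
    have hbdd : BddBelow (Set.range fun w : C => ‖ξ - w‖) :=
      ⟨0, Set.forall_mem_range.2 fun _ => norm_nonneg _⟩
    have : Nonempty C := hne.to_subtype
    constructor
    · rintro ⟨h1, h2⟩
      exact ⟨h1, le_antisymm (le_ciInf fun w => h2 w w.2) (ciInf_le hbdd ⟨p, h1⟩)⟩
    · rintro ⟨h1, h2⟩
      exact ⟨h1, fun z hz => h2.le.trans (ciInf_le hbdd ⟨z, hz⟩)⟩
  obtain ⟨p, hp, hpe⟩ := exists_norm_eq_iInf_of_complete_convex hne hcl.isComplete hconv ξ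
  refine ⟨p, (hiff p).2 ⟨hp, hpe⟩, ?_⟩
  intro q hq
  obtain ⟨hq1, hq2⟩ := (hiff q).1 hq
  have h1 := (norm_eq_iInf_iff_real_inner_le_zero hconv hp).1 hpe q hq1
  have h2 := (norm_eq_iInf_iff_real_inner_le_zero hconv hq1).1 hq2 p hp
  have h3 : inner ℝ (ξ - q) (p - q) + inner ℝ (ξ - p) (q - p) = ‖q - p‖ ^ 2 := by
    rw [← real_inner_self_eq_norm_sq, ← neg_sub q p, inner_neg_right, ← sub_eq_neg_add,
      ← inner_sub_left]
    congr 1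
    abel
  have h4 : ‖q - p‖ = 0 := by
    have : ‖q - p‖ ^ 2 ≤ 0 := by linarith
    exact pow_eq_zero_iff two_ne_zero |>.1 (le_antisymm this (sq_nonneg _))
  exact sub_eq_zero.1 (norm_eq_zero.1 h4)

theorem isNearestPoint_metricProj [CompleteSpace X] {C : Set X} (hne : C.Nonempty)
    (hcl : IsClosed C) (hconv : Convex ℝ C) (ξ : X) : IsNearestPoint C ξ (metricProj C ξ) :=
  Classical.epsilon_spec (existsUnique_isNearestPoint hne hcl hconv ξ).exists

end Projection

section Method

variable {X Y : Type*} [NormedAddCommGroup X] [InnerProductSpace ℝ X] [CompleteSpace X]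
  [NormedAddCommGroup Y] [InnerProductSpace ℝ Y] [CompleteSpace Y]

/-- `x` solves `min {½‖x‖² : x ∈ C and A x = y}`. -/
def IsMinNormSolution (A : X →L[ℝ] Y) (C : Set X) (y : Y) (x : X) : Prop :=
  (x ∈ C ∧ A x = y) ∧ ∀ z ∈ C, A z = y → (1 / 2 : ℝ) * ‖x‖ ^ 2 ≤ (1 / 2 : ℝ) * ‖z‖ ^ 2

/-- The dual iterates `λ₀ = 0`, `λ_{n+1} = λ_n - γ (A P_C(A* λ_n) - yδ)`. -/
def dualIter (A : X →L[ℝ] Y) (C : Set X) (γ : ℝ) (yδ : Y) : ℕ → Y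
  | 0 => 0
  | n + 1 => dualIter A C γ yδ n -
      γ • (A (metricProj C (A.adjoint (dualIter A C γ yδ n))) - yδ)

/-- The primal iterates `x_n = P_C(A* λ_n)` of the dual projected Landweber iteration. -/
def iter (A : X →L[ℝ] Y) (C : Set X) (γ : ℝ) (yδ : Y) (n : ℕ) : X :=
  metricProj C (A.adjoint (dualIter A C γ yδ n))

/-- `n` is the index at which the discrepancy principle stops:
`‖A x_n - yδ‖ ≤ τ δ < ‖A x_m - yδ‖` for all `0 ≤ m < n`. -/
def IsDiscrepancyIndex (A : X →L[ℝ] Y) (C : Set X) (γ τ δ : ℝ) (yδ : Y) (n : ℕ) : Prop :=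
  ‖A (iter A C γ yδ n) - yδ‖ ≤ τ * δ ∧ ∀ m < n, τ * δ < ‖A (iter A C γ yδ m) - yδ‖

/-- The projected source condition `x† = P_C((A*A)^{ν/2} ω)`. -/
def ProjectedSourceCondition (A : X →L[ℝ] Y) (C : Set X) (ν : ℝ) (ω xdag : X) : Prop :=
  xdag = metricProj C (opPow (A.adjoint ∘L A) (ν / 2) ω)

end Method

end DualLandweber

end

/-!
# Convergence and rates of the dual projected Landweber iteration

The conjugate `g` of `½‖·‖²` restricted to `C` is convex and `1`-smooth with gradient `P_C`
(`conj_add_inner_le`, `conj_le`). Hence the iteration is gradient descent on the dual objective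
`λ ↦ g (A* λ) - ⟪λ, yδ⟫`. For exact data `y` the shifted objective
`D(λ) = g (A* λ) - ⟪λ, y⟫ + ½‖x†‖²` is the duality gap `dualGap`, and strong convexity of `½‖·‖²`
gives `½‖P_C (A* λ) - x†‖² ≤ D(λ)` (`half_norm_sq_le_dualGap`), so only `D(λ_n)` has to be bounded.

The gradient descent estimate `dualIter_bound` compares `λ_n` with an arbitrary `μ`. A priori, it
yields `D(λ_n) ≤ D(μ) + ‖μ‖² / (2 γ n) + γ n δ² / 2` (`half_norm_sq_iter_sub_le`). Under the
discrepancy principle the residuals before stopping exceed `τ δ`, which adds a term quadratic in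
`n δ` that more than absorbs the noise (`stopping_bound`); this bounds `n` and the distance
`‖λ_n - μ‖`, and together with the small residual at the stopping index and convexity it gives
`D(λ_n) ≤ K (D(μ) + δ ‖μ‖)` for every `μ` (`half_norm_sq_discrepancy_le`).

It remains to choose `μ`. Without a source condition, strong duality `inf D = 0`
(`exists_dualGap_lt`) suffices for convergence. If `x† = P_C(ξ)` with `ξ = (A*A)^{ν/2} ω`, then
`D(μ) ≤ ½‖A* μ - ξ‖²` (`dualGap_le_half_norm_sq`), and Tikhonov regularization of `A* μ = ξ` with
parameter `δ ^ (2 / (1 + ν))` makes both `D(μ)` and `δ ‖μ‖` of order `δ ^ (2 ν / (1 + ν))`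
(`exists_dualGap_le_rate`).
-/

open Filter Topology Asymptotics

noncomputable section

namespace DualLandweber

/-! ### The conjugate of the half squared norm on `C` -/

section Conjugate

variable {X : Type*} [NormedAddCommGroup X] [InnerProductSpace ℝ X]

theorem IsNearestPoint.inner_le_zero {C : Set X} (hconv : Convex ℝ C) {ξ p : X}
    (hp : IsNearestPoint C ξ p) {z : X} (hz : z ∈ C) : inner ℝ (ξ - p) (z - p) ≤ 0 := by
  have : Nonempty C := ⟨⟨p, hp.1⟩⟩
  have hbdd : BddBelow (Set.range fun w : C => ‖ξ - w‖) :=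
    ⟨0, Set.forall_mem_range.2 fun _ => norm_nonneg _⟩
  refine (norm_eq_iInf_iff_real_inner_le_zero hconv hp.1).1 ?_ z hz
  exact le_antisymm (le_ciInf fun w => hp.2 w w.2) (ciInf_le hbdd ⟨p, hp.1⟩)

theorem isNearestPoint_of_inner_le_zero {C : Set X} {ξ p : X} (hp : p ∈ C)
    (h : ∀ z ∈ C, inner ℝ (ξ - p) (z - p) ≤ 0) : IsNearestPoint C ξ p := by
  refine ⟨hp, fun z hz => ?_⟩
  have h1 : ‖ξ - z‖ ^ 2 = ‖ξ - p‖ ^ 2 - 2 * inner ℝ (ξ - p) (z - p) + ‖z - p‖ ^ 2 := by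
    rw [← norm_sub_sq_real, sub_sub_sub_cancel_right]
  have h2 := h z hz
  refine le_of_sq_le_sq ?_ (norm_nonneg _)
  nlinarith [sq_nonneg ‖z - p‖]

/-- The value of the convex conjugate of `x ↦ ½‖x‖²` restricted to `C`, that is of
`ξ ↦ sup {⟪ξ, z⟫ - ½‖z‖² : z ∈ C}`, written at its maximizer, the metric projection of `ξ`. -/
def conj (C : Set X) (ξ : X) : ℝ :=
  inner ℝ ξ (metricProj C ξ) - 1 / 2 * ‖metricProj C ξ‖ ^ 2

variable [CompleteSpace X] {C : Set X}

/-- Fenchel–Young inequality with the quadratic gain that comes from strong convexity. -/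
theorem inner_sub_le_conj (hcl : IsClosed C) (hconv : Convex ℝ C) (ξ : X) {z : X} (hz : z ∈ C) :
    inner ℝ ξ z - 1 / 2 * ‖z‖ ^ 2 + 1 / 2 * ‖z - metricProj C ξ‖ ^ 2 ≤ conj C ξ := by
  have h := (isNearestPoint_metricProj ⟨z, hz⟩ hcl hconv ξ).inner_le_zero hconv hz
  rw [conj, norm_sub_sq_real]
  rw [inner_sub_left, inner_sub_right, inner_sub_right, real_inner_self_eq_norm_sq,
    real_inner_comm z (metricProj C ξ)] at h
  linarith

/-- The metric projection of `ξ` is a subgradient of the conjugate at `ξ`. -/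
theorem conj_add_inner_le (hne : C.Nonempty) (hcl : IsClosed C) (hconv : Convex ℝ C) (ξ η : X) :
    conj C ξ + inner ℝ (metricProj C ξ) (η - ξ) ≤ conj C η := by
  have h := inner_sub_le_conj hcl hconv η (isNearestPoint_metricProj hne hcl hconv ξ).1
  have h0 := sq_nonneg ‖metricProj C ξ - metricProj C η‖
  rw [inner_sub_right, real_inner_comm η, real_inner_comm ξ, conj]
  linarith

/-- The conjugate is `1`-smooth: this is dual to the strong convexity of `½‖x‖²`. -/
theorem conj_le (hne : C.Nonempty) (hcl : IsClosed C) (hconv : Convex ℝ C) (ξ η : X) :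
    conj C η ≤ conj C ξ + inner ℝ (metricProj C ξ) (η - ξ) + 1 / 2 * ‖η - ξ‖ ^ 2 := by
  have h := inner_sub_le_conj hcl hconv ξ (isNearestPoint_metricProj hne hcl hconv η).1
  rw [conj]
  set p := metricProj C ξ
  set q := metricProj C η
  have h1 : 0 ≤ ‖(η - ξ) - (q - p)‖ ^ 2 := sq_nonneg _
  rw [norm_sub_sq_real, inner_sub_right, inner_sub_left η ξ q] at h1
  rw [real_inner_comm (η - ξ) p]
  linarith

end Conjugate

/-! ### Gradient descent for smooth convex functions -/

section GradientDescent

variable {Y : Type*} [NormedAddCommGroup Y] [InnerProductSpace ℝ Y]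

/-- Gradient descent with step `γ ≤ 1 / L` on a convex `L`-smooth function. When the gradients
met so far have norm at least `ρ`, the usual bound improves by a term quadratic in the number of
steps. -/
theorem gradient_descent_bound {F : Y → ℝ} {G : Y → Y} {γ L ρ : ℝ} (hγ : 0 < γ) (hL : 0 ≤ L)
    (hγL : γ * L ≤ 1) (hρ : 0 ≤ ρ)
    (hconvex : ∀ l m, F l + inner ℝ (G l) (m - l) ≤ F m)
    (hsmooth : ∀ l m, F m ≤ F l + inner ℝ (G l) (m - l) + L / 2 * ‖m - l‖ ^ 2)
    {l : ℕ → Y} (h0 : l 0 = 0) (hl : ∀ n, l (n + 1) = l n - γ • G (l n)) (μ : Y) (n : ℕ)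
    (hG : ∀ k < n, ρ ≤ ‖G (l k)‖) :
    2 * γ * (n * (F (l n) - F μ)) + γ ^ 2 * (1 - γ * L) * ρ ^ 2 * n ^ 2 + ‖l n - μ‖ ^ 2
      ≤ ‖μ‖ ^ 2 := by
  induction n with
  | zero => simp [h0]
  | succ n ih =>
    have ih := ih fun k hk => hG k (by omega)
    set g := G (l n) with hg
    -- the sufficient decrease enters with weight `n + 1`, the distance recursion with weight `1`
    have hdesc : F (l (n + 1)) ≤ F (l n) - γ * (1 - γ * L / 2) * ‖g‖ ^ 2 := by
      have h := hsmooth (l n) (l (n + 1))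
      have h1 : l (n + 1) - l n = -(γ • g) := by rw [hl, ← hg]; abel
      rw [h1, ← hg, inner_neg_right, inner_smul_right, real_inner_self_eq_norm_sq, norm_neg,
        norm_smul, Real.norm_of_nonneg hγ.le] at h
      linarith
    have hdist : ‖l (n + 1) - μ‖ ^ 2
        = ‖l n - μ‖ ^ 2 + 2 * γ * inner ℝ g (μ - l n) + γ ^ 2 * ‖g‖ ^ 2 := by
      have h1 : l (n + 1) - μ = (l n - μ) - γ • g := by rw [hl, ← hg]; abel
      rw [h1, norm_sub_sq_real, inner_smul_right, norm_smul, Real.norm_of_nonneg hγ.le,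
        ← neg_sub μ (l n), inner_neg_left, real_inner_comm]
      ring
    have hgn : ρ ^ 2 ≤ ‖g‖ ^ 2 := pow_le_pow_left₀ hρ (hG n (by omega)) 2
    have hc := hconvex (l n) μ
    rw [← hg] at hc
    have hn : (0 : ℝ) ≤ n := n.cast_nonneg
    have h1 : (n + 1 : ℝ) * F (l (n + 1))
        ≤ (n + 1) * (F (l n) - γ * (1 - γ * L / 2) * ‖g‖ ^ 2) := by gcongr
    have h2 : (1 - γ * L) * (2 * n + 1) * ρ ^ 2 ≤ (1 - γ * L) * (2 * n + 1) * ‖g‖ ^ 2 := by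
      have : 0 ≤ 1 - γ * L := by linarith
      gcongr
    have h3 : 0 ≤ γ * L * (n * ‖g‖ ^ 2) := by positivity
    have h1' := mul_le_mul_of_nonneg_left h1 (by positivity : 0 ≤ 2 * γ)
    have h2' := mul_le_mul_of_nonneg_left h2 (by positivity : 0 ≤ γ ^ 2)
    have h3' := mul_nonneg (by positivity : 0 ≤ γ ^ 2) h3
    have hc' := mul_le_mul_of_nonneg_left hc (by positivity : 0 ≤ 2 * γ)
    push_cast
    rw [hdist]
    linarith

end GradientDescent

/-! ### The duality gap -/

section DualGap

variable {X Y : Type*} [NormedAddCommGroup X] [InnerProductSpace ℝ X] [CompleteSpace X]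
  [NormedAddCommGroup Y] [InnerProductSpace ℝ Y] [CompleteSpace Y]

/-- The dual objective `λ ↦ g (A* λ) - ⟪λ, z⟫` for the data `z`, with `g` the conjugate of `½‖·‖²`
on `C`, shifted by the constant `½‖x†‖²`. For exact data it is the gap between the primal optimal
value and the dual value at `λ`. -/
def dualGap (A : X →L[ℝ] Y) (C : Set X) (xdag : X) (z l : Y) : ℝ :=
  conj C (A.adjoint l) - inner ℝ l z + 1 / 2 * ‖xdag‖ ^ 2

variable {A : X →L[ℝ] Y} {C : Set X} {xdag : X} {y : Y}

/-- The duality gap controls the primal error. -/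
theorem half_norm_sq_le_dualGap (hcl : IsClosed C) (hconv : Convex ℝ C) (hx : xdag ∈ C)
    (hA : A xdag = y) (l : Y) :
    1 / 2 * ‖metricProj C (A.adjoint l) - xdag‖ ^ 2 ≤ dualGap A C xdag y l := by
  have h := inner_sub_le_conj hcl hconv (A.adjoint l) hx
  rw [ContinuousLinearMap.adjoint_inner_left, hA] at h
  rw [dualGap, norm_sub_rev]
  linarith

theorem dualGap_nonneg (hcl : IsClosed C) (hconv : Convex ℝ C) (hx : xdag ∈ C)
    (hA : A xdag = y) (l : Y) : 0 ≤ dualGap A C xdag y l :=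
  le_trans (by positivity) (half_norm_sq_le_dualGap hcl hconv hx hA l)

theorem dualGap_add_inner_le (hne : C.Nonempty) (hcl : IsClosed C) (hconv : Convex ℝ C)
    (z l m : Y) :
    dualGap A C xdag z l + inner ℝ (A (metricProj C (A.adjoint l)) - z) (m - l)
      ≤ dualGap A C xdag z m := by
  have h := conj_add_inner_le hne hcl hconv (A.adjoint l) (A.adjoint m)
  rw [← map_sub, ContinuousLinearMap.adjoint_inner_right] at h
  rw [dualGap, dualGap, inner_sub_left, inner_sub_right z, real_inner_comm m z, real_inner_comm l z]
  linarith

theorem dualGap_le (hne : C.Nonempty) (hcl : IsClosed C) (hconv : Convex ℝ C) (z l m : Y) :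
    dualGap A C xdag z m ≤ dualGap A C xdag z l
      + inner ℝ (A (metricProj C (A.adjoint l)) - z) (m - l) + ‖A‖ ^ 2 / 2 * ‖m - l‖ ^ 2 := by
  have h := conj_le hne hcl hconv (A.adjoint l) (A.adjoint m)
  rw [← map_sub, ContinuousLinearMap.adjoint_inner_right] at h
  have h1 : ‖A.adjoint (m - l)‖ ^ 2 ≤ (‖A‖ * ‖m - l‖) ^ 2 := by
    gcongr
    simpa using A.adjoint.le_opNorm (m - l)
  rw [dualGap, dualGap, inner_sub_left, inner_sub_right z, real_inner_comm m z, real_inner_comm l z]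
  linarith

theorem dualGap_perturb (z l : Y) :
    dualGap A C xdag z l = dualGap A C xdag y l - inner ℝ l (z - y) := by
  rw [dualGap, dualGap, inner_sub_right]
  ring

/-- The gradient descent bound for the dual iterates, with the data noise moved to the right-hand
side. -/
theorem dualIter_bound (hne : C.Nonempty) (hcl : IsClosed C) (hconv : Convex ℝ C) {γ δ ρ : ℝ}
    (hγ : 0 < γ) (hγA : γ * ‖A‖ ^ 2 ≤ 1) (hρ : 0 ≤ ρ) {yδ : Y} (hy : ‖yδ - y‖ ≤ δ) (μ : Y) (n : ℕ)
    (hres : ∀ k < n, ρ ≤ ‖A (iter A C γ yδ k) - yδ‖) :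
    2 * γ * (n * dualGap A C xdag y (dualIter A C γ yδ n))
        + γ ^ 2 * (1 - γ * ‖A‖ ^ 2) * ρ ^ 2 * n ^ 2 + ‖dualIter A C γ yδ n - μ‖ ^ 2
      ≤ 2 * γ * n * dualGap A C xdag y μ + ‖μ‖ ^ 2
        + 2 * γ * n * δ * ‖dualIter A C γ yδ n - μ‖ := by
  have h := gradient_descent_bound (F := dualGap A C xdag yδ)
    (G := fun l => A (metricProj C (A.adjoint l)) - yδ) (L := ‖A‖ ^ 2) hγ (sq_nonneg _) hγA hρ
    (dualGap_add_inner_le hne hcl hconv yδ) (dualGap_le hne hcl hconv yδ)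
    (l := dualIter A C γ yδ) rfl (fun _ => rfl) μ n hres
  rw [dualGap_perturb (y := y), dualGap_perturb (y := y) yδ μ] at h
  have h1 : inner ℝ (dualIter A C γ yδ n - μ) (yδ - y) ≤ ‖dualIter A C γ yδ n - μ‖ * δ :=
    (real_inner_le_norm _ _).trans (by gcongr)
  rw [inner_sub_left] at h1
  have h2 := mul_le_mul_of_nonneg_left h1 (by positivity : 0 ≤ 2 * γ * n)
  linarith

end DualGap

/-! ### Error bounds for the two stopping rules -/

section ErrorBounds

/-- With `κ = τ - 1` and `M = D + δ m`, the bound `κ u² + (d - u)² ≤ b` for `u = γ n δ` and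
`b = 2 γ n D + m²` controls `d δ` by `M`, independently of `n`. -/
theorem mul_le_of_stopping_bound {κ γ δ D m d n : ℝ} (hκ : 0 < κ) (hγ : 0 < γ) (hδ : 0 < δ)
    (hD : 0 ≤ D) (hm : 0 ≤ m) (hn : 0 ≤ n)
    (h : κ * (γ * n * δ) ^ 2 + (d - γ * n * δ) ^ 2 ≤ 2 * γ * n * D + m ^ 2) :
    δ * d ≤ 3 * (1 + 1 / κ) * (D + δ * m) := by
  obtain ⟨c, hc⟩ : ∃ c, c = 1 / κ := ⟨_, rfl⟩
  have hcκ : c * κ = 1 := by rw [hc]; field_simp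
  have hc0 : 0 < c := by rw [hc]; positivity
  rw [← hc]
  set M := D + δ * m with hM
  have hM0 : 0 ≤ M := by positivity
  set v := γ * n * δ ^ 2 with hv
  have hv0 : 0 ≤ v := by positivity
  -- the hypothesis scaled by `δ²`, in terms of `v = δ u`
  have hb : κ * v ^ 2 + (δ * d - v) ^ 2 ≤ 2 * v * M + M ^ 2 := by
    have h1 := mul_le_mul_of_nonneg_left h (by positivity : 0 ≤ δ ^ 2)
    have h2 : v * D ≤ v * M := by gcongr; rw [hM]; nlinarith [mul_nonneg hδ.le hm]
    have h3 : (δ * m) ^ 2 ≤ M ^ 2 := by gcongr; linarith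
    have e1 : δ ^ 2 * (κ * (γ * n * δ) ^ 2 + (d - γ * n * δ) ^ 2)
      = κ * v ^ 2 + (δ * d - v) ^ 2 := by rw [hv]; ring
    have e2 : δ ^ 2 * (2 * γ * n * D + m ^ 2) = 2 * (v * D) + (δ * m) ^ 2 := by rw [hv]; ring
    rw [e1, e2] at h1
    linarith
  have hvM : v ≤ (1 + 2 * c) * M := by
    have h1 : v ^ 2 ≤ 2 * c * (v * M) + c * M ^ 2 := by
      have h2 : κ * v ^ 2 ≤ 2 * v * M + M ^ 2 := by nlinarith [sq_nonneg (δ * d - v)]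
      have h3 := mul_le_mul_of_nonneg_left h2 hc0.le
      rw [← mul_assoc, hcκ] at h3
      linarith
    have h2 : (v - c * M) ^ 2 ≤ ((1 + c) * M) ^ 2 := by
      nlinarith [mul_nonneg hc0.le (sq_nonneg M), sq_nonneg M]
    have h3 := le_of_sq_le_sq h2 (by positivity)
    linarith
  have h4 : (δ * d - v) ^ 2 ≤ (2 * (1 + c) * M) ^ 2 := by
    have h5 : v * M ≤ (1 + 2 * c) * M * M := by gcongr
    nlinarith [mul_nonneg hκ.le (sq_nonneg v), mul_nonneg hc0.le (sq_nonneg M), sq_nonneg (c * M)]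
  have h6 := le_of_sq_le_sq h4 (by positivity)
  nlinarith [mul_nonneg hc0.le hM0]

variable {X Y : Type*} [NormedAddCommGroup X] [InnerProductSpace ℝ X] [CompleteSpace X]
  [NormedAddCommGroup Y] [InnerProductSpace ℝ Y] [CompleteSpace Y]
  {A : X →L[ℝ] Y} {C : Set X} {xdag : X} {y : Y}

/-- After `n` steps the error is at most the Tikhonov functional with parameter `1 / (γ n)` at any
`μ`, plus the propagated noise. -/
theorem half_norm_sq_iter_sub_le (hcl : IsClosed C) (hconv : Convex ℝ C) (hx : xdag ∈ C)
    (hA : A xdag = y) {γ δ : ℝ} (hγ : 0 < γ) (hγA : γ * ‖A‖ ^ 2 ≤ 1) {yδ : Y}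
    (hy : ‖yδ - y‖ ≤ δ) (μ : Y) {n : ℕ} (hn : 0 < n) :
    1 / 2 * ‖iter A C γ yδ n - xdag‖ ^ 2
      ≤ dualGap A C xdag y μ + ‖μ‖ ^ 2 / (2 * γ * n) + γ / 2 * (δ ^ 2 * n) := by
  have h := dualIter_bound (xdag := xdag) ⟨xdag, hx⟩ hcl hconv hγ hγA le_rfl hy μ n
    (fun _ _ => norm_nonneg _)
  refine (half_norm_sq_le_dualGap hcl hconv hx hA (dualIter A C γ yδ n)).trans ?_
  have hn' : (0 : ℝ) < n := by exact_mod_cast hn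
  have hp : 0 < 2 * γ * n := by positivity
  have e : dualGap A C xdag y μ + ‖μ‖ ^ 2 / (2 * γ * n) + γ / 2 * (δ ^ 2 * n)
      = (2 * γ * n * dualGap A C xdag y μ + ‖μ‖ ^ 2 + (γ * n * δ) ^ 2) / (2 * γ * n) := by
    field_simp
  rw [e, le_div_iff₀ hp]
  nlinarith [sq_nonneg (‖dualIter A C γ yδ n - μ‖ - γ * n * δ)]

/-- While the residual exceeds `τ δ`, the strict step size condition gives a surplus that absorbs
the propagated noise. -/
theorem stopping_bound (hcl : IsClosed C) (hconv : Convex ℝ C) (hx : xdag ∈ C)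
    (hA : A xdag = y) {τ γ δ : ℝ} (hτ : 1 < τ) (hγ : 0 < γ) (hτγ : 0 < 1 - 1 / τ - ‖A‖ ^ 2 * γ)
    (hδ : 0 < δ) {yδ : Y} (hy : ‖yδ - y‖ ≤ δ) (μ : Y) {n : ℕ}
    (hres : ∀ k < n, τ * δ < ‖A (iter A C γ yδ k) - yδ‖) :
    (τ - 1) * (γ * n * δ) ^ 2 + (‖dualIter A C γ yδ n - μ‖ - γ * n * δ) ^ 2
      ≤ 2 * γ * n * dualGap A C xdag y μ + ‖μ‖ ^ 2 := by
  have hτ0 : 0 < τ := by linarith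
  have h1τ : 0 < 1 / τ := by positivity
  have h := dualIter_bound (xdag := xdag) ⟨xdag, hx⟩ hcl hconv hγ (by linarith)
    (by positivity : 0 ≤ τ * δ) hy μ n (fun k hk => (hres k hk).le)
  have h1 : τ ≤ (1 - γ * ‖A‖ ^ 2) * τ ^ 2 := by
    have h2 : 1 / τ * τ ^ 2 ≤ (1 - γ * ‖A‖ ^ 2) * τ ^ 2 := by gcongr; linarith
    have h3 : 1 / τ * τ ^ 2 = τ := by field_simp
    linarith
  have h4 := mul_le_mul_of_nonneg_right h1 (sq_nonneg (γ * n * δ))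
  have h5 : 0 ≤ 2 * γ * (n * dualGap A C xdag y (dualIter A C γ yδ n)) := by
    have := dualGap_nonneg hcl hconv hx hA (dualIter A C γ yδ n)
    positivity
  linarith

theorem existsUnique_discrepancyIndex (hcl : IsClosed C) (hconv : Convex ℝ C) (hx : xdag ∈ C)
    (hA : A xdag = y) {τ γ δ : ℝ} (hτ : 1 < τ) (hγ : 0 < γ) (hτγ : 0 < 1 - 1 / τ - ‖A‖ ^ 2 * γ)
    (hδ : 0 < δ) {yδ : Y} (hy : ‖yδ - y‖ ≤ δ) : ∃! n, IsDiscrepancyIndex A C γ τ δ yδ n := by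
  classical
  have hex : ∃ n, ‖A (iter A C γ yδ n) - yδ‖ ≤ τ * δ := by
    by_contra! hcon
    -- with `μ = 0` the bound is quadratic in `n` on the left and linear on the right
    set D := dualGap A C xdag y 0 with hD
    obtain ⟨n, hn⟩ := exists_nat_gt (2 * D / ((τ - 1) * γ * δ ^ 2))
    have hD0 : 0 ≤ D := dualGap_nonneg hcl hconv hx hA 0
    have hκ : 0 < τ - 1 := by linarith
    have h := stopping_bound hcl hconv hx hA hτ hγ hτγ hδ hy 0 (n := n) (fun k _ => hcon k)
    rw [div_lt_iff₀ (by positivity)] at hn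
    have hn0 : (0 : ℝ) < n := by
      rcases (n.cast_nonneg : (0 : ℝ) ≤ n).eq_or_lt with h0 | h0
      · rw [← h0] at hn
        linarith
      · exact h0
    have h1 := mul_lt_mul_of_pos_left hn (by positivity : 0 < γ * n)
    rw [← hD, norm_zero] at h
    nlinarith [sq_nonneg (‖dualIter A C γ yδ n - 0‖ - γ * n * δ)]
  refine ⟨Nat.find hex, ⟨Nat.find_spec hex, fun m hm => not_le.1 (Nat.find_min hex hm)⟩, ?_⟩
  rintro n ⟨h1, h2⟩
  refine ((Nat.find_eq_iff hex).2 ⟨h1, fun m hm => not_le.2 (h2 m hm)⟩).symm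

/-- At the discrepancy index the error is controlled by `D(μ) + δ ‖μ‖` for every `μ`, where `D` is
the duality gap: the residual is at most `τ δ`, so by convexity the gap exceeds `D(μ)` by at most
`(τ + 1) δ` times the distance from the dual iterate to `μ`. -/
theorem half_norm_sq_discrepancy_le (hcl : IsClosed C) (hconv : Convex ℝ C) (hx : xdag ∈ C)
    (hA : A xdag = y) {τ γ δ : ℝ} (hτ : 1 < τ) (hγ : 0 < γ) (hτγ : 0 < 1 - 1 / τ - ‖A‖ ^ 2 * γ)
    (hδ : 0 < δ) {yδ : Y} (hy : ‖yδ - y‖ ≤ δ) (μ : Y) {n : ℕ}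
    (hn : IsDiscrepancyIndex A C γ τ δ yδ n) :
    1 / 2 * ‖iter A C γ yδ n - xdag‖ ^ 2
      ≤ (1 + 3 * (τ + 1) * (1 + 1 / (τ - 1))) * (dualGap A C xdag y μ + δ * ‖μ‖) := by
  refine (half_norm_sq_le_dualGap hcl hconv hx hA (dualIter A C γ yδ n)).trans ?_
  have hD0 := dualGap_nonneg hcl hconv hx hA μ
  have h1 := mul_le_of_stopping_bound (by linarith : 0 < τ - 1) hγ hδ hD0 (norm_nonneg μ)
    n.cast_nonneg (stopping_bound hcl hconv hx hA hτ hγ hτγ hδ hy μ hn.2)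
  have h2 := dualGap_add_inner_le (A := A) (xdag := xdag) ⟨xdag, hx⟩ hcl hconv y
    (dualIter A C γ yδ n) μ
  have h3 : ‖A (iter A C γ yδ n) - y‖ ≤ (τ + 1) * δ := by
    have := norm_sub_le_norm_sub_add_norm_sub (A (iter A C γ yδ n)) yδ y
    linarith [hn.1]
  have h4 := (abs_le.1 (abs_real_inner_le_norm (A (iter A C γ yδ n) - y)
    (μ - dualIter A C γ yδ n))).1
  rw [norm_sub_rev μ] at h4
  have h5 := mul_le_mul_of_nonneg_right h3 (norm_nonneg (dualIter A C γ yδ n - μ))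
  have h6 := mul_le_mul_of_nonneg_left h1 (by linarith : 0 ≤ τ + 1)
  have h7 : 0 ≤ δ * ‖μ‖ := by positivity
  rw [iter] at h4 h5
  linarith

end ErrorBounds

/-! ### Strong duality -/

section StrongDuality

variable {X Y : Type*} [NormedAddCommGroup X] [InnerProductSpace ℝ X]
  [NormedAddCommGroup Y] [InnerProductSpace ℝ Y]
  {A : X →L[ℝ] Y} {C : Set X} {xdag : X} {y : Y}

theorem isMinNormSolution_iff {x : X} :
    IsMinNormSolution A C y x ↔ IsNearestPoint {x | x ∈ C ∧ A x = y} 0 x := by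
  simp only [IsMinNormSolution, IsNearestPoint, Set.mem_ofPred_eq, zero_sub, norm_neg, and_imp]
  refine and_congr_right fun _ => forall₃_congr fun z _ _ => ?_
  rw [mul_le_mul_iff_right₀ (by norm_num), pow_le_pow_iff_left₀ (norm_nonneg _) (norm_nonneg _)
    two_ne_zero]

variable [CompleteSpace X]

theorem existsUnique_isMinNormSolution (hcl : IsClosed C) (hconv : Convex ℝ C)
    (hsol : ∃ x ∈ C, A x = y) : ∃! x, IsMinNormSolution A C y x := by
  simp only [isMinNormSolution_iff]
  refine existsUnique_isNearestPoint hsol ?_ ?_ 0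
  · exact hcl.inter (isClosed_eq A.continuous continuous_const)
  · exact hconv.inter ((convex_singleton y).linear_preimage A.toLinearMap)

variable [CompleteSpace Y]

/-- The Tikhonov functional `‖x‖² + c² ‖A x - y‖²` has a minimizer over `C`, stated through its
variational inequality. It is obtained by projecting the origin onto the graph of `c (A x - y)`
over `C` in the Hilbert sum `X ⊕ Y`. -/
theorem exists_tikhonov (hne : C.Nonempty) (hcl : IsClosed C) (hconv : Convex ℝ C)
    (A : X →L[ℝ] Y) (y : Y) (c : ℝ) :
    ∃ x ∈ C, ∀ z ∈ C, 0 ≤ inner ℝ x (z - x) + c ^ 2 * inner ℝ (A x - y) (A (z - x)) := by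
  let f : X → WithLp 2 (X × Y) := fun x => WithLp.toLp 2 (x, c • (A x - y))
  have hG : f '' C = (fun p : WithLp 2 (X × Y) => p.fst) ⁻¹' C
      ∩ {p | p.snd = c • (A p.fst - y)} := by
    ext p
    constructor
    · rintro ⟨x, hx, rfl⟩
      exact ⟨hx, rfl⟩
    · rintro ⟨h1, h2⟩
      refine ⟨p.fst, h1, ?_⟩
      change WithLp.toLp 2 (p.fst, c • (A p.fst - y)) = p
      rw [← (h2 : p.snd = _)]
      rfl
  have hfst : Continuous fun p : WithLp 2 (X × Y) => p.fst :=
    continuous_fst.comp (WithLp.prod_continuous_ofLp 2 X Y)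
  have hsnd : Continuous fun p : WithLp 2 (X × Y) => p.snd :=
    continuous_snd.comp (WithLp.prod_continuous_ofLp 2 X Y)
  have hclosed : IsClosed (f '' C) := by
    rw [hG]
    exact (hcl.preimage hfst).inter (isClosed_eq hsnd (by fun_prop))
  have hconvex : Convex ℝ (f '' C) := by
    rintro _ ⟨x, hx, rfl⟩ _ ⟨z, hz, rfl⟩ a b ha hb hab
    refine ⟨a • x + b • z, hconv hx hz ha hb hab, ?_⟩
    have h : c • (A (a • x + b • z) - y) = a • (c • (A x - y)) + b • (c • (A z - y)) := by
      rw [← eq_sub_iff_add_eq'] at hab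
      rw [hab, map_add, map_smul, map_smul]
      module
    exact congrArg (fun v => WithLp.toLp 2 (a • x + b • z, v)) h
  obtain ⟨p, hp, -⟩ := existsUnique_isNearestPoint (hne.image f) hclosed hconvex 0
  obtain ⟨x, hx, rfl⟩ := hp.1
  refine ⟨x, hx, fun z hz => ?_⟩
  have h := hp.inner_le_zero hconvex ⟨z, hz, rfl⟩
  rw [WithLp.prod_inner_apply] at h
  have e1 : (0 - f x).ofLp.1 = -x := by simp [f]
  have e2 : (0 - f x).ofLp.2 = -(c • (A x - y)) := by simp [f]
  have e3 : (f z - f x).ofLp.1 = z - x := rfl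
  have e4 : (f z - f x).ofLp.2 = c • A (z - x) := by
    change c • (A z - y) - c • (A x - y) = _
    rw [map_sub]
    module
  rw [e1, e2, e3, e4, inner_neg_left, inner_neg_left, inner_smul_left, inner_smul_right] at h
  simp only [conj_trivial] at h
  linarith

/-- Strong duality: the duality gap has infimum zero, although it need not be attained. The dual
points are the scaled residuals of the Tikhonov minimizers over `C`, which converge to the
minimum-norm solution as the penalty grows. -/
theorem exists_dualGap_lt (hcl : IsClosed C) (hconv : Convex ℝ C)
    (hx : IsMinNormSolution A C y xdag) {ε : ℝ} (hε : 0 < ε) :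
    ∃ μ, dualGap A C xdag y μ < ε := by
  have hne : C.Nonempty := ⟨xdag, hx.1.1⟩
  choose x hxC hxv using fun k : ℕ => exists_tikhonov hne hcl hconv A y k
  set r : ℕ → ℝ := fun k => ‖A (x k) - y‖ ^ 2 with hr
  set m : ℕ → ℝ := fun k => ‖x k‖ ^ 2 + k ^ 2 * r k with hm
  -- the `k`-th Tikhonov functional exceeds its minimum `m k` by at least the squared distance to
  -- its minimizer
  have hgrow : ∀ k, ∀ z ∈ C, m k + ‖z - x k‖ ^ 2 ≤ ‖z‖ ^ 2 + k ^ 2 * ‖A z - y‖ ^ 2 := by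
    intro k z hz
    have h := hxv k z hz
    have h1 : ‖z‖ ^ 2 = ‖x k‖ ^ 2 + 2 * inner ℝ (x k) (z - x k) + ‖z - x k‖ ^ 2 := by
      rw [← norm_add_sq_real, add_sub_cancel]
    have h2 : ‖A z - y‖ ^ 2 = r k + 2 * inner ℝ (A (x k) - y) (A (z - x k))
        + ‖A (z - x k)‖ ^ 2 := by
      rw [hr, ← norm_add_sq_real, map_sub]
      congr 2
      abel
    rw [h1, h2, hm]
    have h3 : 0 ≤ (k : ℝ) ^ 2 * ‖A (z - x k)‖ ^ 2 := by positivity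
    linarith
  have hmle : ∀ k, m k ≤ ‖xdag‖ ^ 2 := by
    intro k
    have h := hgrow k xdag hx.1.1
    rw [hx.1.2, sub_self, norm_zero] at h
    nlinarith [sq_nonneg ‖xdag - x k‖]
  have hstep : ∀ k l, k ≤ l → ‖x l - x k‖ ^ 2 ≤ m l - m k := by
    intro k l hkl
    have h := hgrow k (x l) (hxC l)
    have h1 : (k : ℝ) ^ 2 * r l ≤ (l : ℝ) ^ 2 * r l := by
      have : (k : ℝ) ≤ l := by exact_mod_cast hkl
      have : 0 ≤ r l := sq_nonneg _
      gcongr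
    have h2 : m l = ‖x l‖ ^ 2 + l ^ 2 * r l := rfl
    linarith
  have hmono : Monotone m := fun k l hkl => by
    linarith [hstep k l hkl, sq_nonneg ‖x l - x k‖]
  -- the minima increase and are bounded, and their increments control `‖x l - x k‖²`
  have hbdd : BddAbove (Set.range m) := ⟨‖xdag‖ ^ 2, Set.forall_mem_range.2 hmle⟩
  have hlim := tendsto_atTop_ciSup hmono hbdd
  set s := ⨆ k, m k
  have hcauchy : CauchySeq x := by
    refine cauchySeq_of_le_tendsto_0' (fun k => √(s - m k)) (fun k l hkl => ?_) ?_
    · rw [dist_comm, dist_eq_norm]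
      refine Real.le_sqrt_of_sq_le ((hstep k l hkl).trans ?_)
      linarith [le_ciSup hbdd l]
    · have h : Tendsto (fun k => √(s - m k)) atTop (𝓝 √(s - s)) := (hlim.const_sub s).sqrt
      simpa using h
  obtain ⟨w, hw⟩ := cauchySeq_tendsto_of_complete hcauchy
  have hwC : w ∈ C := hcl.mem_of_tendsto hw (Eventually.of_forall hxC)
  have hwA : A w = y := by
    have h1 : Tendsto r atTop (𝓝 (‖A w - y‖ ^ 2)) :=
      (((A.continuous.tendsto w).comp hw).sub_const y).norm.pow 2
    have h2 : Tendsto r atTop (𝓝 0) := by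
      refine squeeze_zero' (g := fun k : ℕ => ‖xdag‖ ^ 2 * (1 / (k : ℝ)))
        (Eventually.of_forall fun k => sq_nonneg _) ?_ ?_
      · filter_upwards [eventually_ge_atTop 1] with k hk
        have hk' : (1 : ℝ) ≤ k := by exact_mod_cast hk
        rw [mul_one_div, le_div_iff₀ (by linarith)]
        have h3 := hmle k
        have h4 : 0 ≤ r k := sq_nonneg _
        have h5 : (k : ℝ) * r k ≤ k ^ 2 * r k := by gcongr; nlinarith
        have h6 : m k = ‖x k‖ ^ 2 + k ^ 2 * r k := rfl
        nlinarith [sq_nonneg ‖x k‖]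
      · simpa using tendsto_one_div_atTop_nhds_zero_nat (𝕜 := ℝ).const_mul (‖xdag‖ ^ 2)
    have h3 := tendsto_nhds_unique h1 h2
    simpa [sub_eq_zero] using h3
  have hnorm : Tendsto (fun k => ‖x k‖ ^ 2) atTop (𝓝 (‖w‖ ^ 2)) := hw.norm.pow 2
  have hle : ‖xdag‖ ^ 2 ≤ ‖w‖ ^ 2 := by linarith [hx.2 w hwC hwA]
  obtain ⟨k, hk⟩ := (hnorm.eventually (lt_mem_nhds (by linarith : ‖xdag‖ ^ 2 - ε < ‖w‖ ^ 2))).exists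
  refine ⟨(k : ℝ) ^ 2 • (y - A (x k)), ?_⟩
  set μ := (k : ℝ) ^ 2 • (y - A (x k)) with hμ
  -- the variational inequality says that `x k` is the projection of `A* μ`
  have hproj : metricProj C (A.adjoint μ) = x k := by
    refine (existsUnique_isNearestPoint hne hcl hconv _).unique
      (isNearestPoint_metricProj hne hcl hconv _) (isNearestPoint_of_inner_le_zero (hxC k) ?_)
    intro z hz
    have h := hxv k z hz
    rw [inner_sub_left, ContinuousLinearMap.adjoint_inner_left, hμ, inner_smul_left,
      ← neg_sub (A (x k)) y, inner_neg_left]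
    simp only [conj_trivial]
    linarith
  -- hence the gap at `μ` is `½‖x†‖² - ½‖x k‖² - k² ‖A (x k) - y‖²`
  have hinner : inner ℝ μ (A (x k)) - inner ℝ μ y = -((k : ℝ) ^ 2 * r k) := by
    rw [← inner_sub_right, hμ, inner_smul_left, ← neg_sub (A (x k)) y, inner_neg_left,
      real_inner_self_eq_norm_sq]
    simp [hr]
  have hpos : 0 ≤ (k : ℝ) ^ 2 * r k := mul_nonneg (sq_nonneg _) (sq_nonneg _)
  rw [dualGap, conj, hproj, ContinuousLinearMap.adjoint_inner_left]
  linarith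

end StrongDuality

/-! ### The projected source condition -/

section Source

open Polynomial

/-- `t ↦ t ^ s / (t + α)` is the Tikhonov approximation of `t ↦ t ^ (s - 1)`; a polynomial close to
it inherits its two bounds, up to a factor `2`. -/
theorem exists_polynomial_tikhonov {s α b : ℝ} (hs : 0 ≤ s) (hs2 : s ≤ 1 / 2) (hα : 0 < α) :
    ∃ q : ℝ[X], ∀ t ∈ Set.Icc 0 b,
      |t * q.eval t - t ^ s| ≤ 2 * α ^ s ∧ t * q.eval t ^ 2 ≤ (2 * α ^ (s - 1 / 2)) ^ 2 := by
  have hyoung : ∀ t a : ℝ, 0 ≤ t → 0 ≤ a → a ≤ 1 → t ^ a * α ^ (1 - a) ≤ t + α := by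
    intro t a ht ha ha1
    calc t ^ a * α ^ (1 - a) ≤ (t + α) ^ a * (t + α) ^ (1 - a) := by
          have : 0 ≤ 1 - a := by linarith
          gcongr <;> linarith
      _ = t + α := by
          rw [← Real.rpow_add (by linarith), add_sub_cancel, Real.rpow_one]
  have hcont : ContinuousOn (fun t : ℝ => t ^ s / (t + α)) (Set.Icc 0 b) := by
    refine (Real.continuous_rpow_const hs).continuousOn.div (by fun_prop) fun t ht => ?_
    linarith [ht.1]
  -- both `t * e` and `√t * e` are within the stated bounds for `t ∈ [0, b]`
  set e := min (α ^ s) (α ^ (s - 1 / 2)) / (|b| + 1) with he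
  have hb1 : 0 < |b| + 1 := by positivity
  have he0 : 0 < e := by positivity
  obtain ⟨q, hq⟩ := exists_polynomial_near_of_continuousOn 0 b _ hcont e he0
  refine ⟨q, fun t ht => ?_⟩
  have htb : t ≤ |b| + 1 := by linarith [ht.2, le_abs_self b]
  have hsb : √t ≤ |b| + 1 := by
    rw [Real.sqrt_le_iff]
    exact ⟨hb1.le, by nlinarith [ht.2, le_abs_self b, abs_nonneg b]⟩
  have hebd : (|b| + 1) * e = min (α ^ s) (α ^ (s - 1 / 2)) := by rw [he]; field_simp
  have htα : 0 < t + α := by linarith [ht.1]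
  set h := t ^ s / (t + α) with hh
  have hq' : |q.eval t - h| ≤ e := (hq t ht).le
  have hh0 : 0 ≤ h := div_nonneg (Real.rpow_nonneg ht.1 _) htα.le
  constructor
  · have h1 : |t * h - t ^ s| ≤ α ^ s := by
      have e1 : t * h - t ^ s = -(α * t ^ s / (t + α)) := by rw [hh]; field_simp; ring
      rw [e1, abs_neg, abs_of_nonneg (div_nonneg (mul_nonneg hα.le (Real.rpow_nonneg ht.1 _))
        htα.le), div_le_iff₀ htα]
      have e2 : α ^ s * α ^ (1 - s) = α := by
        rw [← Real.rpow_add hα, add_sub_cancel, Real.rpow_one]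
      calc α * t ^ s = α ^ s * (t ^ s * α ^ (1 - s)) := by rw [mul_left_comm, e2, mul_comm]
        _ ≤ α ^ s * (t + α) := by gcongr; exact hyoung t s ht.1 hs (by linarith)
    have h2 : |t * (q.eval t - h)| ≤ α ^ s := by
      rw [abs_mul, abs_of_nonneg ht.1]
      calc t * |q.eval t - h| ≤ (|b| + 1) * e := by gcongr
        _ ≤ α ^ s := hebd ▸ min_le_left _ _
    have e3 : t * q.eval t - t ^ s = t * (q.eval t - h) + (t * h - t ^ s) := by ring
    rw [e3]
    linarith [abs_add_le (t * (q.eval t - h)) (t * h - t ^ s)]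
  · have h1 : √t * h ≤ α ^ (s - 1 / 2) := by
      rw [hh, ← mul_div_assoc, div_le_iff₀ htα, Real.sqrt_eq_rpow,
        ← Real.rpow_add_of_nonneg ht.1 (by norm_num) hs]
      calc t ^ (1 / 2 + s) = α ^ (s - 1 / 2) * (t ^ (1 / 2 + s) * α ^ (1 - (1 / 2 + s))) := by
            have e4 : s - 1 / 2 + (1 - (1 / 2 + s)) = 0 := by ring
            rw [mul_left_comm, ← Real.rpow_add hα, e4, Real.rpow_zero, mul_one]
        _ ≤ α ^ (s - 1 / 2) * (t + α) := by
            gcongr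
            exact hyoung t _ ht.1 (by linarith) (by linarith)
    have h2 : √t * |q.eval t - h| ≤ α ^ (s - 1 / 2) := by
      calc √t * |q.eval t - h| ≤ (|b| + 1) * e := by gcongr
        _ ≤ α ^ (s - 1 / 2) := hebd ▸ min_le_right _ _
    have h3 : |q.eval t| ≤ |q.eval t - h| + h := by
      have h4 := abs_add_le (q.eval t - h) h
      rwa [sub_add_cancel, abs_of_nonneg hh0] at h4
    have h5 : √t * |q.eval t| ≤ 2 * α ^ (s - 1 / 2) := by
      have := mul_le_mul_of_nonneg_left h3 (Real.sqrt_nonneg t)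
      linarith
    calc t * q.eval t ^ 2 = (√t * |q.eval t|) ^ 2 := by
          rw [mul_pow, Real.sq_sqrt ht.1, sq_abs]
      _ ≤ (2 * α ^ (s - 1 / 2)) ^ 2 := by gcongr

theorem norm_aeval_sub_opPow_le {H : Type*} [NormedAddCommGroup H] [InnerProductSpace ℝ H]
    [CompleteSpace H] {T : H →L[ℝ] H} (hT : T.IsPositive) {s : ℝ} (hs : 0 ≤ s) (q : ℝ[X]) {K : ℝ}
    (hK : ∀ t ∈ Set.Icc 0 ‖T‖, |q.eval t - t ^ s| ≤ K) : ‖aeval T q - opPow T s‖ ≤ K := by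
  obtain ⟨p, hp, hlim⟩ := isOpPow_opPow hT hs
  refine le_of_forall_pos_le_add fun e he => ?_
  refine le_of_tendsto (hlim.const_sub (aeval T q)).norm ?_
  rw [Metric.tendstoUniformlyOn_iff] at hp
  filter_upwards [hp e he] with k hk
  rw [← map_sub]
  refine norm_aeval_le hT _ fun t ht => ?_
  have h1 := hk t ht
  rw [Real.dist_eq] at h1
  have e1 : (q - p k).eval t = (q.eval t - t ^ s) + (t ^ s - (p k).eval t) := by
    rw [eval_sub]
    ring
  rw [e1]
  linarith [abs_add_le (q.eval t - t ^ s) (t ^ s - (p k).eval t), hK t ht]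

variable {X Y : Type*} [NormedAddCommGroup X] [InnerProductSpace ℝ X] [CompleteSpace X]
  [NormedAddCommGroup Y] [InnerProductSpace ℝ Y] [CompleteSpace Y]
  {A : X →L[ℝ] Y} {C : Set X} {xdag : X} {y : Y}

/-- If `x†` is the projection of `ξ`, smoothness of the conjugate at `ξ` bounds the duality gap by
the distance from `A* μ` to `ξ`. -/
theorem dualGap_le_half_norm_sq (hne : C.Nonempty) (hcl : IsClosed C) (hconv : Convex ℝ C)
    (hA : A xdag = y) {ξ : X} (hξ : xdag = metricProj C ξ) (μ : Y) :
    dualGap A C xdag y μ ≤ 1 / 2 * ‖A.adjoint μ - ξ‖ ^ 2 := by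
  have h := conj_le hne hcl hconv ξ (A.adjoint μ)
  have h1 : conj C ξ = inner ℝ ξ xdag - 1 / 2 * ‖xdag‖ ^ 2 := by rw [conj, ← hξ]
  rw [h1, ← hξ, inner_sub_right, ContinuousLinearMap.adjoint_inner_right, hA,
    real_inner_comm ξ xdag, real_inner_comm μ y] at h
  rw [dualGap]
  linarith

/-- Under the projected source condition, `μ = A q(A*A) ω` with `q` a polynomial version of the
Tikhonov filter balances the duality gap against the norm of `μ`. -/
theorem exists_dualGap_le_of_source (hne : C.Nonempty) (hcl : IsClosed C) (hconv : Convex ℝ C)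
    (hA : A xdag = y) {ν α : ℝ} {ω : X} (hν : 0 < ν) (hν1 : ν ≤ 1)
    (hsrc : ProjectedSourceCondition A C ν ω xdag) (hα : 0 < α) :
    ∃ μ : Y, dualGap A C xdag y μ ≤ 2 * (α ^ (ν / 2) * ‖ω‖) ^ 2 ∧
      ‖μ‖ ≤ 2 * α ^ (ν / 2 - 1 / 2) * ‖ω‖ := by
  set T := A.adjoint ∘L A with hTdef
  have hT : T.IsPositive := ContinuousLinearMap.isPositive_adjoint_comp_self A
  obtain ⟨q, hq⟩ := exists_polynomial_tikhonov (s := ν / 2) (b := ‖T‖) (by linarith) (by linarith)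
    hα
  refine ⟨A (aeval T q ω), ?_, ?_⟩
  · refine (dualGap_le_half_norm_sq hne hcl hconv hA hsrc _).trans ?_
    have h1 : ‖aeval T (Polynomial.X * q) - opPow T (ν / 2)‖ ≤ 2 * α ^ (ν / 2) :=
      norm_aeval_sub_opPow_le hT (by linarith) _ fun t ht => by
        rw [eval_mul, eval_X]
        exact (hq t ht).1
    have e1 : A.adjoint (A (aeval T q ω)) - opPow T (ν / 2) ω
        = (aeval T (Polynomial.X * q) - opPow T (ν / 2)) ω := by
      rw [map_mul, aeval_X]
      rfl
    have h2 : ‖A.adjoint (A (aeval T q ω)) - opPow T (ν / 2) ω‖ ≤ 2 * (α ^ (ν / 2) * ‖ω‖) := by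
      rw [e1, ← mul_assoc]
      exact ContinuousLinearMap.le_of_opNorm_le _ h1 ω
    have h3 := pow_le_pow_left₀ (norm_nonneg _) h2 2
    linarith
  · have h1 : ‖aeval T (Polynomial.X * q ^ 2)‖ ≤ (2 * α ^ (ν / 2 - 1 / 2)) ^ 2 :=
      norm_aeval_le hT _ fun t ht => by
        rw [eval_mul, eval_X, eval_pow, abs_of_nonneg (mul_nonneg ht.1 (sq_nonneg _))]
        exact (hq t ht).2
    have e1 : ‖A (aeval T q ω)‖ ^ 2 = inner ℝ (aeval T (Polynomial.X * q ^ 2) ω) ω := by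
      have h2 : aeval T (Polynomial.X * q ^ 2) = aeval T q * (T * aeval T q) := by
        have : (Polynomial.X * q ^ 2 : ℝ[X]) = q * (Polynomial.X * q) := by ring
        rw [this, map_mul, map_mul, aeval_X]
      have h3 := (isSelfAdjoint_aeval hT.isSelfAdjoint q).isSymmetric (T (aeval T q ω)) ω
      rw [h2]
      refine Eq.trans ?_ h3.symm
      rw [hTdef, ContinuousLinearMap.comp_apply, ContinuousLinearMap.adjoint_inner_left]
      exact (real_inner_self_eq_norm_sq _).symm
    refine le_of_sq_le_sq ?_ (by positivity)
    rw [e1]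
    calc inner ℝ (aeval T (Polynomial.X * q ^ 2) ω) ω
        ≤ ‖aeval T (Polynomial.X * q ^ 2) ω‖ * ‖ω‖ := real_inner_le_norm _ _
      _ ≤ ((2 * α ^ (ν / 2 - 1 / 2)) ^ 2 * ‖ω‖) * ‖ω‖ := by
          gcongr
          exact ContinuousLinearMap.le_of_opNorm_le _ h1 ω
      _ = (2 * α ^ (ν / 2 - 1 / 2) * ‖ω‖) ^ 2 := by ring

/-- The choice `α = δ ^ (2 / (1 + ν))` makes both `D(μ)` and `δ ‖μ‖` of the order of the squared
optimal rate. -/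
theorem exists_dualGap_le_rate (hne : C.Nonempty) (hcl : IsClosed C) (hconv : Convex ℝ C)
    (hA : A xdag = y) {ν δ : ℝ} {ω : X} (hν : 0 < ν) (hν1 : ν ≤ 1)
    (hsrc : ProjectedSourceCondition A C ν ω xdag) (hδ : 0 < δ) :
    ∃ μ : Y, dualGap A C xdag y μ ≤ 2 * ‖ω‖ ^ 2 * (δ ^ (ν / (1 + ν))) ^ 2 ∧
      δ * ‖μ‖ ≤ 2 * ‖ω‖ * (δ ^ (ν / (1 + ν))) ^ 2 := by
  obtain ⟨μ, h1, h2⟩ := exists_dualGap_le_of_source hne hcl hconv hA hν hν1 hsrc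
    (Real.rpow_pos_of_pos hδ (2 / (1 + ν)))
  have hν2 : 1 + ν ≠ 0 := by linarith
  refine ⟨μ, ?_, ?_⟩
  · rw [← Real.rpow_mul hδ.le] at h1
    have e : 2 / (1 + ν) * (ν / 2) = ν / (1 + ν) := by field_simp
    rw [e] at h1
    linarith
  · have e : δ * (δ ^ (2 / (1 + ν))) ^ (ν / 2 - 1 / 2) = (δ ^ (ν / (1 + ν))) ^ 2 := by
      rw [← Real.rpow_mul hδ.le, ← Real.rpow_mul_natCast hδ.le, ← Real.rpow_one_add' hδ.le]
      · congr 1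
        field_simp
        push_cast
        ring
      · have : 1 + 2 / (1 + ν) * (ν / 2 - 1 / 2) = 2 * ν / (1 + ν) := by
          field_simp
          ring
        rw [this]
        positivity
    calc δ * ‖μ‖ ≤ δ * (2 * (δ ^ (2 / (1 + ν))) ^ (ν / 2 - 1 / 2) * ‖ω‖) := by gcongr
      _ = 2 * ‖ω‖ * (δ * (δ ^ (2 / (1 + ν))) ^ (ν / 2 - 1 / 2)) := by ring
      _ = 2 * ‖ω‖ * (δ ^ (ν / (1 + ν))) ^ 2 := by rw [e]

end Source

/-! ### Convergence and rates -/

theorem le_sqrt_mul_of_half_sq_le {a K R : ℝ} (hR : 0 ≤ R) (h : 1 / 2 * a ^ 2 ≤ K * R ^ 2) :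
    a ≤ √(2 * K) * R := by
  have h1 : a ≤ √(2 * K * R ^ 2) := Real.le_sqrt_of_sq_le (by linarith)
  rwa [Real.sqrt_mul' _ (sq_nonneg R), Real.sqrt_sq hR] at h1

section Convergence

variable {X Y : Type*} [NormedAddCommGroup X] [InnerProductSpace ℝ X] [CompleteSpace X]
  [NormedAddCommGroup Y] [InnerProductSpace ℝ Y] [CompleteSpace Y]
  {A : X →L[ℝ] Y} {C : Set X} {xdag : X} {y : Y}

theorem apriori_convergence (hcl : IsClosed C) (hconv : Convex ℝ C)
    (hx : IsMinNormSolution A C y xdag) {γ : ℝ} (hγ : 0 < γ) (hγA : γ * ‖A‖ ^ 2 ≤ 1)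
    {n : ℝ → ℕ} (hn : Tendsto n (𝓝[>] 0) atTop)
    (hnδ : Tendsto (fun δ : ℝ => δ ^ 2 * (n δ : ℝ)) (𝓝[>] 0) (𝓝 0)) {ε : ℝ} (hε : 0 < ε) :
    ∀ᶠ δ in 𝓝[>] (0 : ℝ), ∀ yδ : Y, ‖yδ - y‖ ≤ δ → ‖iter A C γ yδ (n δ) - xdag‖ < ε := by
  obtain ⟨μ, hμ⟩ := exists_dualGap_lt hcl hconv hx (by positivity : 0 < 1 / 2 * ε ^ 2)
  have hlim : Tendsto (fun δ => dualGap A C xdag y μ + ‖μ‖ ^ 2 / (2 * γ * n δ)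
      + γ / 2 * (δ ^ 2 * n δ)) (𝓝[>] 0) (𝓝 (dualGap A C xdag y μ + 0 + γ / 2 * 0)) := by
    refine (tendsto_const_nhds.add ?_).add (hnδ.const_mul _)
    have hn' : Tendsto (fun δ => (n δ : ℝ)) (𝓝[>] 0) atTop := tendsto_natCast_atTop_atTop.comp hn
    exact tendsto_const_nhds.div_atTop (hn'.const_mul_atTop (by positivity))
  rw [add_zero, mul_zero, add_zero] at hlim
  filter_upwards [hlim.eventually (gt_mem_nhds hμ), hn.eventually_gt_atTop 0] with δ h1 h2 yδ hy
  have h3 := half_norm_sq_iter_sub_le hcl hconv hx.1.1 hx.1.2 hγ hγA hy μ h2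
  refine lt_of_pow_lt_pow_left₀ 2 hε.le ?_
  linarith

theorem apriori_rate (hcl : IsClosed C) (hconv : Convex ℝ C)
    (hx : IsMinNormSolution A C y xdag) {γ : ℝ} (hγ : 0 < γ) (hγA : γ * ‖A‖ ^ 2 ≤ 1)
    {ν : ℝ} {ω : X} (hν : 0 < ν) (hν1 : ν ≤ 1) (hsrc : ProjectedSourceCondition A C ν ω xdag)
    {n : ℝ → ℕ}
    (hn : (fun δ : ℝ => (n δ : ℝ)) =Θ[𝓝[>] 0] (fun δ : ℝ => δ ^ (-(2 / (1 + ν))))) :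
    ∃ K : ℝ, ∀ᶠ δ in 𝓝[>] (0 : ℝ), ∀ yδ : Y, ‖yδ - y‖ ≤ δ →
      ‖iter A C γ yδ (n δ) - xdag‖ ≤ K * δ ^ (ν / (1 + ν)) := by
  obtain ⟨c₁, hc₁, h₁⟩ := hn.1.exists_pos
  obtain ⟨c₂, hc₂, h₂⟩ := hn.2.exists_pos
  refine ⟨√(2 * (2 * ‖ω‖ ^ 2 + 2 * ‖ω‖ ^ 2 * c₂ / γ + γ / 2 * c₁)), ?_⟩
  filter_upwards [h₁.bound, h₂.bound, self_mem_nhdsWithin] with δ hu hl hδ yδ hy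
  rw [Set.mem_Ioi] at hδ
  have hν2 : 1 + ν ≠ 0 := by linarith
  set R := δ ^ (ν / (1 + ν)) with hR
  set N := δ ^ (-(2 / (1 + ν))) with hN
  have hR0 : 0 < R := Real.rpow_pos_of_pos hδ _
  have hN0 : 0 < N := Real.rpow_pos_of_pos hδ _
  rw [Real.norm_of_nonneg (n δ).cast_nonneg, Real.norm_of_nonneg hN0.le] at hu hl
  -- in terms of the rate `R`, the condition on `n δ` says that `δ² n δ` is of the order of `R²`
  have hNR : δ ^ 2 * N = R ^ 2 := by
    rw [hN, hR, ← Real.rpow_mul_natCast hδ.le, ← Real.rpow_natCast δ 2, ← Real.rpow_add hδ]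
    congr 1
    field_simp
    push_cast
    ring
  have hn0 : (0 : ℝ) < n δ := by
    by_contra! h
    nlinarith
  have hup : δ ^ 2 * n δ ≤ c₁ * R ^ 2 := by
    rw [← hNR]
    nlinarith [mul_le_mul_of_nonneg_left hu (sq_nonneg δ)]
  have hlo : R ^ 2 ≤ c₂ * (δ ^ 2 * n δ) := by
    rw [← hNR]
    nlinarith [mul_le_mul_of_nonneg_left hl (sq_nonneg δ)]
  obtain ⟨μ, hμ1, hμ2⟩ := exists_dualGap_le_rate ⟨xdag, hx.1.1⟩ hcl hconv hx.1.2 hν hν1 hsrc hδ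
  rw [← hR] at hμ1 hμ2
  have h3 := half_norm_sq_iter_sub_le hcl hconv hx.1.1 hx.1.2 hγ hγA hy μ (by exact_mod_cast hn0)
  have h4 : ‖μ‖ ^ 2 / (2 * γ * n δ) ≤ 2 * ‖ω‖ ^ 2 * c₂ / γ * R ^ 2 := by
    rw [div_le_iff₀ (by positivity)]
    have h5 := pow_le_pow_left₀ (by positivity) hμ2 2
    have h6 := mul_le_mul_of_nonneg_left hlo (by positivity : 0 ≤ 4 * ‖ω‖ ^ 2 * R ^ 2)
    refine le_of_mul_le_mul_left ?_ (by positivity : 0 < δ ^ 2)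
    calc δ ^ 2 * ‖μ‖ ^ 2 ≤ 4 * ‖ω‖ ^ 2 * R ^ 2 * (c₂ * (δ ^ 2 * n δ)) := by linarith
      _ = δ ^ 2 * (2 * ‖ω‖ ^ 2 * c₂ / γ * R ^ 2 * (2 * γ * n δ)) := by
          field_simp
          ring
  refine le_sqrt_mul_of_half_sq_le hR0.le ?_
  have h7 := mul_le_mul_of_nonneg_left hup (by positivity : 0 ≤ γ / 2)
  linarith

theorem discrepancy_convergence (hcl : IsClosed C) (hconv : Convex ℝ C)
    (hx : IsMinNormSolution A C y xdag) {τ γ : ℝ} (hτ : 1 < τ) (hγ : 0 < γ)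
    (hτγ : 0 < 1 - 1 / τ - ‖A‖ ^ 2 * γ) {ε : ℝ} (hε : 0 < ε) :
    ∀ᶠ δ in 𝓝[>] (0 : ℝ), ∀ yδ : Y, ‖yδ - y‖ ≤ δ →
      ∀ n : ℕ, IsDiscrepancyIndex A C γ τ δ yδ n → ‖iter A C γ yδ n - xdag‖ < ε := by
  have hκ : 0 < τ - 1 := by linarith
  set K := 1 + 3 * (τ + 1) * (1 + 1 / (τ - 1)) with hK
  have hK0 : 0 < K := by positivity
  obtain ⟨μ, hμ⟩ := exists_dualGap_lt hcl hconv hx (by positivity : 0 < 1 / 2 * ε ^ 2 / K)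
  have hlim : Tendsto (fun δ => K * (dualGap A C xdag y μ + δ * ‖μ‖)) (𝓝[>] 0)
      (𝓝 (K * (dualGap A C xdag y μ + 0 * ‖μ‖))) := by
    refine Tendsto.mono_left (Continuous.tendsto ?_ 0) nhdsWithin_le_nhds
    fun_prop
  have hlt : K * (dualGap A C xdag y μ + 0 * ‖μ‖) < 1 / 2 * ε ^ 2 := by
    rw [lt_div_iff₀ hK0] at hμ
    linarith
  filter_upwards [hlim.eventually (gt_mem_nhds hlt), self_mem_nhdsWithin] with δ h1 hδ yδ hy n hn
  have h3 := half_norm_sq_discrepancy_le hcl hconv hx.1.1 hx.1.2 hτ hγ hτγ hδ hy μ hn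
  refine lt_of_pow_lt_pow_left₀ 2 hε.le ?_
  linarith

theorem discrepancy_rate (hcl : IsClosed C) (hconv : Convex ℝ C)
    (hx : IsMinNormSolution A C y xdag) {τ γ : ℝ} (hτ : 1 < τ) (hγ : 0 < γ)
    (hτγ : 0 < 1 - 1 / τ - ‖A‖ ^ 2 * γ) {ν : ℝ} {ω : X} (hν : 0 < ν) (hν1 : ν ≤ 1)
    (hsrc : ProjectedSourceCondition A C ν ω xdag) :
    ∃ K : ℝ, ∀ᶠ δ in 𝓝[>] (0 : ℝ), ∀ yδ : Y, ‖yδ - y‖ ≤ δ →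
      ∀ n : ℕ, IsDiscrepancyIndex A C γ τ δ yδ n →
        ‖iter A C γ yδ n - xdag‖ ≤ K * δ ^ (ν / (1 + ν)) := by
  have hκ : 0 < τ - 1 := by linarith
  set K := 1 + 3 * (τ + 1) * (1 + 1 / (τ - 1)) with hK
  have hK0 : 0 < K := by positivity
  refine ⟨√(2 * (K * (2 * ‖ω‖ ^ 2 + 2 * ‖ω‖))), ?_⟩
  filter_upwards [self_mem_nhdsWithin] with δ hδ yδ hy n hn
  obtain ⟨μ, hμ1, hμ2⟩ := exists_dualGap_le_rate ⟨xdag, hx.1.1⟩ hcl hconv hx.1.2 hν hν1 hsrc hδ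
  have h3 := half_norm_sq_discrepancy_le hcl hconv hx.1.1 hx.1.2 hτ hγ hτγ hδ hy μ hn
  refine le_sqrt_mul_of_half_sq_le (Real.rpow_nonneg (le_of_lt hδ) _) (h3.trans ?_)
  rw [← hK, mul_assoc]
  refine mul_le_mul_of_nonneg_left ?_ hK0.le
  linarith

end Convergence

end DualLandweber

end

open DualLandweber in
theorem corollary4p1
    {X Y : Type*} [NormedAddCommGroup X] [InnerProductSpace ℝ X] [CompleteSpace X]
    [NormedAddCommGroup Y] [InnerProductSpace ℝ Y] [CompleteSpace Y]
    (A : X →L[ℝ] Y) (C : Set X) (hCclosed : IsClosed C) (hCconvex : Convex ℝ C)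
    (y : Y) (hsol : ∃ x ∈ C, A x = y) :
    (∃! x, IsMinNormSolution A C y x) ∧
    ∀ xdag : X, IsMinNormSolution A C y xdag →
      -- (i) a priori stopping rules
      (∀ γ : ℝ, 0 < γ → γ * ‖A‖ ^ 2 ≤ 1 →
        (∀ n : ℝ → ℕ, Tendsto n (𝓝[>] 0) atTop →
          Tendsto (fun δ : ℝ => δ ^ 2 * (n δ : ℝ)) (𝓝[>] 0) (𝓝 0) →
          ∀ ε > 0, ∀ᶠ δ in 𝓝[>] (0 : ℝ), ∀ yδ : Y, ‖yδ - y‖ ≤ δ →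
            ‖iter A C γ yδ (n δ) - xdag‖ < ε) ∧
        (∀ (ν : ℝ) (ω : X), 0 < ν → ν ≤ 1 → ProjectedSourceCondition A C ν ω xdag →
          ∀ n : ℝ → ℕ, (fun δ : ℝ => (n δ : ℝ)) =Θ[𝓝[>] 0] (fun δ : ℝ => δ ^ (-(2 / (1 + ν)))) →
          ∃ K : ℝ, ∀ᶠ δ in 𝓝[>] (0 : ℝ), ∀ yδ : Y, ‖yδ - y‖ ≤ δ →
            ‖iter A C γ yδ (n δ) - xdag‖ ≤ K * δ ^ (ν / (1 + ν)))) ∧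
      -- (ii) the discrepancy principle
      (∀ τ γ : ℝ, 1 < τ → 0 < γ → 0 < 1 - 1 / τ - ‖A‖ ^ 2 * γ →
        (∀ δ > 0, ∀ yδ : Y, ‖yδ - y‖ ≤ δ → ∃! n : ℕ, IsDiscrepancyIndex A C γ τ δ yδ n) ∧
        (∀ ε > 0, ∀ᶠ δ in 𝓝[>] (0 : ℝ), ∀ yδ : Y, ‖yδ - y‖ ≤ δ →
          ∀ n : ℕ, IsDiscrepancyIndex A C γ τ δ yδ n → ‖iter A C γ yδ n - xdag‖ < ε) ∧
        (∀ (ν : ℝ) (ω : X), 0 < ν → ν ≤ 1 → ProjectedSourceCondition A C ν ω xdag →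
          ∃ K : ℝ, ∀ᶠ δ in 𝓝[>] (0 : ℝ), ∀ yδ : Y, ‖yδ - y‖ ≤ δ →
            ∀ n : ℕ, IsDiscrepancyIndex A C γ τ δ yδ n →
              ‖iter A C γ yδ n - xdag‖ ≤ K * δ ^ (ν / (1 + ν)))) := by
  refine ⟨existsUnique_isMinNormSolution hCclosed hCconvex hsol, fun xdag hx => ⟨?_, ?_⟩⟩
  · intro γ hγ hγA
    exact ⟨fun n hn hnδ ε hε => apriori_convergence hCclosed hCconvex hx hγ hγA hn hnδ hε,
      fun ν ω hν hν1 hsrc n hn => apriori_rate hCclosed hCconvex hx hγ hγA hν hν1 hsrc hn⟩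
  · intro τ γ hτ hγ hτγ
    exact ⟨fun δ hδ yδ hy =>
        existsUnique_discrepancyIndex hCclosed hCconvex hx.1.1 hx.1.2 hτ hγ hτγ hδ hy,
      fun ε hε => discrepancy_convergence hCclosed hCconvex hx hτ hγ hτγ hε,
      fun ν ω hν hν1 hsrc => discrepancy_rate hCclosed hCconvex hx hτ hγ hτγ hν hν1 hsrc⟩
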